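/- Let $n>2$, let $M$ be a smooth (Hausdorff) $n$-dimensional manifold and let $(g,\xi,\eta,\varphi,\alpha)$ be an $(LCS)_n$-structure (Lorentzian concircular structure) on $M$: $g$ is a Lorentzian metric with Levi-Civita connection $\nabla$, $\xi$ is a smooth vector field with $g(\xi,\xi)=-1$, $\eta:=g(\xi,\cdot)$, $\varphi:=I+\eta\otimes\xi$, and $\nabla\xi=\alpha(I+\eta\otimes\xi)$, where $\alpha$ is a nowhere zero smooth function on $M$ such that $d\alpha=\rho\,\eta$ for some $\rho\in C^\infty(M)$. Let $S$ be the Ricci tensor of $g$, that is, $S(Y,Z)$ is the trace of $X\mapsto R(X,Y)Z$ with $R(X,Y)Z=\nabla_X\nabla_YZ-\nabla_Y\nabla_XZ-\nabla_{[X,Y]}Z$, and let $(\nabla_XS)(Y,Z)=X(S(Y,Z))-S(\nabla_XY,Z)-S(Y,\nabla_XZ)$. Let $\lambda,\mu$ be smooth functions on $M$ such that $(g,\xi,\lambda,\mu)$ is an almost $\eta$-Ricci soliton: $$\mathcal{L}_\xi g+2S+2\lambda g+2\mu\,\eta\otimes\eta=0 .$$ Then: 1. If $\nabla S=0$, then the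 function $\alpha^2+\xi(\alpha)$ is locally constant. 2. If $\nabla S=\eta\otimes S$, i.e. $(\nabla_XS)(Y,Z)=\eta(X)S(Y,Z)$ for all vector fields $X,Y,Z$, then $\alpha^2+(1+2\alpha)\xi(\alpha)+\xi(\xi(\alpha))=0$ on $M$. 3. If $S$ is Codazzi, i.e. $(\nabla_XS)(Y,Z)=(\nabla_YS)(X,Z)$ for all vector fields $X,Y,Z$, then $d(\alpha^2+\xi(\alpha))\otimes\eta=\eta\otimes d(\alpha^2+\xi(\alpha))$. -/

import Mathlib

open scoped Manifold ContDiff Bundle Topology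

noncomputable section

/-- A smooth pseudo-Riemannian metric on the smooth manifold `M`: a smooth section
of symmetric, nondegenerate bilinear forms on the tangent spaces. -/
structure PseudoRiemannianMetric {E : Type*} [NormedAddCommGroup E] [NormedSpace ℝ E]
    {H : Type*} [TopologicalSpace H] (I : ModelWithCorners ℝ E H) (M : Type*) [TopologicalSpace M]
    [ChartedSpace H M] [IsManifold I ∞ M] where
  /-- The bilinear form `g_x`. -/
  val : ∀ x : M, TangentSpace I x →L[ℝ] TangentSpace I x →L[ℝ] ℝ
  symm : ∀ (x : M) (v w : TangentSpace I x), val x v w = val x w v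
  nondegenerate : ∀ (x : M) (v : TangentSpace I x), (∀ w, val x v w = 0) → v = 0
  contMDiff : ContMDiff I
    (I.prod 𝓘(ℝ, E →L[ℝ] E →L[ℝ] ℝ)) ∞
    (fun x ↦ Bundle.TotalSpace.mk'
      (E →L[ℝ] E →L[ℝ] ℝ) x (val x))

/-- The function `ξ(f) = df(ξ)`. -/
def VectorField.dirDeriv {E : Type*} [NormedAddCommGroup E] [NormedSpace ℝ E]
    {H : Type*} [TopologicalSpace H] {I : ModelWithCorners ℝ E H} {M : Type*} [TopologicalSpace M]
    [ChartedSpace H M] (ξ : ∀ x : M, TangentSpace I x) (f : M → ℝ) (x : M) : ℝ :=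
  d% f x (ξ x)

namespace PseudoRiemannianMetric

section

variable {E : Type*} [NormedAddCommGroup E] [NormedSpace ℝ E]
  {H : Type*} [TopologicalSpace H] {I : ModelWithCorners ℝ E H}
  {M : Type*} [TopologicalSpace M] [ChartedSpace H M]

theorem finiteDimensional_tangentSpace [FiniteDimensional ℝ E] (x : M) : FiniteDimensional ℝ (TangentSpace I x) :=
  inferInstanceAs (FiniteDimensional ℝ E)

variable [IsManifold I ∞ M] (g : PseudoRiemannianMetric I M)

/-- The function `x ↦ g_x (X x, Y x)`. -/
def inner (X Y : ∀ x : M, TangentSpace I x) (x : M) : ℝ := g.val x (X x) (Y x)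

/-- The bilinear form `g_x`, without its continuity. -/
def bilin (x : M) : LinearMap.BilinForm ℝ (TangentSpace I x) :=
  LinearMap.mk₂ ℝ (fun v w ↦ g.val x v w) (by simp) (by simp) (by simp) (by simp)

theorem bilin_nondegenerate (x : M) : (g.bilin x).Nondegenerate :=
  ⟨fun v hv ↦ g.nondegenerate x v hv,
    fun v hv ↦ g.nondegenerate x v fun w ↦ (g.symm x v w).trans (hv w)⟩

/-- The vector `g`-dual to a covector: `g_x (♯θ, w) = θ w`. -/
def sharp [FiniteDimensional ℝ E] (x : M) (θ : TangentSpace I x →L[ℝ] ℝ) : TangentSpace I x :=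
  haveI : FiniteDimensional ℝ (TangentSpace I x) := finiteDimensional_tangentSpace x
  ((g.bilin x).toDual (g.bilin_nondegenerate x)).symm θ.toLinearMap

theorem val_sharp [FiniteDimensional ℝ E] (x : M) (θ : TangentSpace I x →L[ℝ] ℝ)
    (w : TangentSpace I x) :
    g.val x (g.sharp x θ) w = θ w :=
  haveI : FiniteDimensional ℝ (TangentSpace I x) := finiteDimensional_tangentSpace x
  LinearMap.BilinForm.apply_toDual_symm_apply (B := g.bilin x) (hB := g.bilin_nondegenerate x)
    θ.toLinearMap w

theorem eq_of_val_eq {x : M} {v w : TangentSpace I x}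
    (h : ∀ u, g.val x v u = g.val x w u) : v = w := by
  rw [← sub_eq_zero]
  exact g.nondegenerate x _ fun u ↦ by simp [h u]

theorem mdifferentiableAt_inner {X Y : ∀ x : M, TangentSpace I x} {x : M}
    (hX : MDiffAt (T% X) x) (hY : MDiffAt (T% Y) x) : MDiffAt (g.inner X Y) x := by
  have h : MDifferentiableAt I (I.prod 𝓘(ℝ))
      (fun m ↦ Bundle.TotalSpace.mk' ℝ (E := Bundle.Trivial M ℝ) m (g.val m (X m) (Y m))) x := by
    apply MDifferentiableAt.clm_bundle_apply₂ (F₁ := E)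
      (F₂ := E)
    · exact (g.contMDiff.mdifferentiable (by simp)).mdifferentiableAt
    · exact hX
    · exact hY
  simp only [mdifferentiableAt_totalSpace] at h
  exact h.2

/-- The right-hand side of the Koszul formula,
`X g(Y,Z) + Y g(X,Z) - Z g(X,Y) + g([X,Y],Z) - g([X,Z],Y) - g([Y,Z],X)`. -/
def koszul (X Y Z : ∀ x : M, TangentSpace I x) (x : M) : ℝ :=
  d% (g.inner Y Z) x (X x) + d% (g.inner X Z) x (Y x) - d% (g.inner X Y) x (Z x)
    + g.val x (VectorField.mlieBracket I X Y x) (Z x)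
    - g.val x (VectorField.mlieBracket I X Z x) (Y x)
    - g.val x (VectorField.mlieBracket I Y Z x) (X x)

variable {X Y Z X' Y' Z' : ∀ x : M, TangentSpace I x} {x : M} {f : M → ℝ}

theorem inner_comm (X Y : ∀ x : M, TangentSpace I x) : g.inner X Y = g.inner Y X := by
  ext y; exact g.symm y _ _

theorem mvfderiv_inner_add (hX : MDiffAt (T% X) x) (hX' : MDiffAt (T% X') x)
    (hY : MDiffAt (T% Y) x) :
    d% (g.inner (X + X') Y) x = d% (g.inner X Y) x + d% (g.inner X' Y) x := by
  rw [← mvfderiv_fun_add (g.mdifferentiableAt_inner hX hY) (g.mdifferentiableAt_inner hX' hY)]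
  congr 1
  ext y
  simp [inner]

theorem mvfderiv_inner_smul (hf : MDiffAt f x) (hX : MDiffAt (T% X) x) (hY : MDiffAt (T% Y) x) :
    d% (g.inner (f • X) Y) x = f x • d% (g.inner X Y) x + g.val x (X x) (Y x) • d% f x := by
  rw [← inner, ← mvfderiv_fun_mul hf (g.mdifferentiableAt_inner hX hY)]
  congr 1
  ext y
  simp [inner]

theorem mvfderiv_inner_add_right (hX : MDiffAt (T% X) x) (hY : MDiffAt (T% Y) x)
    (hY' : MDiffAt (T% Y') x) :
    d% (g.inner X (Y + Y')) x = d% (g.inner X Y) x + d% (g.inner X Y') x := by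
  rw [g.inner_comm X, g.mvfderiv_inner_add hY hY' hX, g.inner_comm Y, g.inner_comm Y']

theorem mvfderiv_inner_smul_right (hf : MDiffAt f x) (hX : MDiffAt (T% X) x)
    (hY : MDiffAt (T% Y) x) :
    d% (g.inner X (f • Y)) x = f x • d% (g.inner X Y) x + g.val x (X x) (Y x) • d% f x := by
  rw [g.inner_comm X, g.mvfderiv_inner_smul hf hY hX, g.inner_comm Y, g.symm x (Y x)]

variable [FiniteDimensional ℝ E]

theorem koszul_add_left (hX : MDiffAt (T% X) x) (hX' : MDiffAt (T% X') x)
    (hY : MDiffAt (T% Y) x) (hZ : MDiffAt (T% Z) x) :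
    g.koszul (X + X') Y Z x = g.koszul X Y Z x + g.koszul X' Y Z x := by
  simp only [koszul, g.mvfderiv_inner_add hX hX' hZ, g.mvfderiv_inner_add hX hX' hY,
    VectorField.mlieBracket_add_left hX hX', Pi.add_apply, map_add, add_apply]
  ring

theorem koszul_smul_left (hf : MDiffAt f x) (hX : MDiffAt (T% X) x)
    (hY : MDiffAt (T% Y) x) (hZ : MDiffAt (T% Z) x) :
    g.koszul (f • X) Y Z x = f x * g.koszul X Y Z x := by
  simp only [koszul, g.mvfderiv_inner_smul hf hX hZ, g.mvfderiv_inner_smul hf hX hY,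
    VectorField.mlieBracket_smul_left hf hX, Pi.smul_apply', map_add, map_smul, add_apply,
    smul_apply, smul_eq_mul, map_neg, neg_apply, neg_smul]
  rw [g.symm x (X x) (Y x)]
  ring

theorem koszul_add_right (hX : MDiffAt (T% X) x) (hY : MDiffAt (T% Y) x)
    (hZ : MDiffAt (T% Z) x) (hZ' : MDiffAt (T% Z') x) :
    g.koszul X Y (Z + Z') x = g.koszul X Y Z x + g.koszul X Y Z' x := by
  simp only [koszul, g.mvfderiv_inner_add_right hX hZ hZ', g.mvfderiv_inner_add_right hY hZ hZ',
    VectorField.mlieBracket_add_right hZ hZ', Pi.add_apply, map_add, add_apply]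
  ring

theorem koszul_smul_right (hf : MDiffAt f x) (hX : MDiffAt (T% X) x)
    (hY : MDiffAt (T% Y) x) (hZ : MDiffAt (T% Z) x) :
    g.koszul X Y (f • Z) x = f x * g.koszul X Y Z x := by
  simp only [koszul, g.mvfderiv_inner_smul_right hf hX hZ, g.mvfderiv_inner_smul_right hf hY hZ,
    VectorField.mlieBracket_smul_right hf hZ, Pi.smul_apply', map_add, map_smul, add_apply,
    smul_apply, smul_eq_mul]
  rw [g.symm x (Z x) (Y x), g.symm x (Z x) (X x)]
  ring

theorem koszul_add_middle (hX : MDiffAt (T% X) x) (hY : MDiffAt (T% Y) x)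
    (hY' : MDiffAt (T% Y') x) (hZ : MDiffAt (T% Z) x) :
    g.koszul X (Y + Y') Z x = g.koszul X Y Z x + g.koszul X Y' Z x := by
  simp only [koszul, g.mvfderiv_inner_add_right hX hY hY', g.mvfderiv_inner_add hY hY' hZ,
    VectorField.mlieBracket_add_left hY hY', VectorField.mlieBracket_add_right hY hY',
    Pi.add_apply, map_add, add_apply]
  ring

theorem koszul_smul_middle (hf : MDiffAt f x) (hX : MDiffAt (T% X) x)
    (hY : MDiffAt (T% Y) x) (hZ : MDiffAt (T% Z) x) :
    g.koszul X (f • Y) Z x =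
      f x * g.koszul X Y Z x + 2 * (d% f x (X x) * g.val x (Y x) (Z x)) := by
  simp only [koszul, g.mvfderiv_inner_smul_right hf hX hY, g.mvfderiv_inner_smul hf hY hZ,
    VectorField.mlieBracket_smul_left hf hY, VectorField.mlieBracket_smul_right hf hY,
    Pi.smul_apply', map_add, map_smul, add_apply, smul_apply, smul_eq_mul, neg_smul, map_neg,
    neg_apply]
  rw [g.symm x (Y x) (X x)]
  ring

theorem tensorialAt_koszul_left (hY : MDiffAt (T% Y) x) (hZ : MDiffAt (T% Z) x) :
    TensorialAt I E (fun X ↦ g.koszul X Y Z x) x where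
  smul hf hX := g.koszul_smul_left hf hX hY hZ
  add hX hX' := g.koszul_add_left hX hX' hY hZ

theorem tensorialAt_koszul_right (hY : MDiffAt (T% Y) x) (hX : MDiffAt (T% X) x) :
    TensorialAt I E (fun Z ↦ g.koszul X Y Z x) x where
  smul hf hZ := g.koszul_smul_right hf hX hY hZ
  add hZ hZ' := g.koszul_add_right hX hY hZ hZ'

/-- For a field `Y` differentiable at `x`, the right-hand side of the Koszul formula at `x` as a
bilinear form in `X x` and `Z x`. -/
def koszulForm (Y : ∀ x : M, TangentSpace I x) (x : M) (hY : MDiffAt (T% Y) x) :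
    TangentSpace I x →L[ℝ] TangentSpace I x →L[ℝ] ℝ :=
  TensorialAt.mkHom₂ (fun X Z ↦ g.koszul X Y Z x) x
    (fun _ hZ ↦ g.tensorialAt_koszul_left hY hZ) (fun _ hX ↦ g.tensorialAt_koszul_right hY hX)

theorem koszulForm_apply (hX : MDiffAt (T% X) x) (hY : MDiffAt (T% Y) x)
    (hZ : MDiffAt (T% Z) x) : g.koszulForm Y x hY (X x) (Z x) = g.koszul X Y Z x :=
  TensorialAt.mkHom₂_apply (Φ := fun X Z ↦ g.koszul X Y Z x) _ _ hX hZ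

open Classical in
/-- The covariant derivative at `x` of the field `Y`, as the linear map `v ↦ ∇_v Y` determined by
the Koszul formula `2 g(∇_X Y, Z) = X g(Y,Z) + Y g(X,Z) - Z g(X,Y) + g([X,Y],Z) - g([X,Z],Y) -
g([Y,Z],X)`. It is zero where `Y` is not differentiable. -/
def nabla (Y : ∀ x : M, TangentSpace I x) (x : M) : TangentSpace I x →L[ℝ] TangentSpace I x :=
  if hY : MDiffAt (T% Y) x then
    haveI : FiniteDimensional ℝ (TangentSpace I x) := finiteDimensional_tangentSpace x
    haveI : T2Space (TangentSpace I x) := inferInstanceAs (T2Space E)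
    LinearMap.toContinuousLinearMap
      { toFun := fun v ↦ g.sharp x ((1 / 2 : ℝ) • g.koszulForm Y x hY v)
        map_add' := fun v w ↦ g.eq_of_val_eq fun u ↦ by
          simp only [g.val_sharp, map_add, add_apply, smul_apply, smul_add]
        map_smul' := fun c v ↦ g.eq_of_val_eq fun u ↦ by
          simp only [g.val_sharp, map_smul, smul_apply, RingHom.id_apply, smul_eq_mul]
          ring }
  else 0

theorem val_nabla (hX : MDiffAt (T% X) x) (hY : MDiffAt (T% Y) x) (hZ : MDiffAt (T% Z) x) :
    g.val x (g.nabla Y x (X x)) (Z x) = 1 / 2 * g.koszul X Y Z x := by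
  rw [nabla, dif_pos hY, ← g.koszulForm_apply hX hY hZ]
  exact g.val_sharp x _ _

theorem ext_fields {A B : TangentSpace I x →L[ℝ] TangentSpace I x}
    (h : ∀ X Z : ∀ x : M, TangentSpace I x, MDiffAt (T% X) x → MDiffAt (T% Z) x →
      g.val x (A (X x)) (Z x) = g.val x (B (X x)) (Z x)) : A = B := by
  ext1 v
  refine g.eq_of_val_eq fun u ↦ ?_
  have := h (FiberBundle.extend E v) (FiberBundle.extend E u)
    (FiberBundle.mdifferentiableAt_extend ..) (FiberBundle.mdifferentiableAt_extend ..)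
  simpa using this

/-- The Levi-Civita connection of `g`. The value `∇_X Y` at `x` is `g.leviCivita Y x (X x)`. -/
def leviCivita : CovariantDerivative I E (TangentSpace I : M → Type _) where
  toFun := g.nabla
  isCovariantDerivativeOnUniv :=
    { add := fun {Y Y' x} hY hY' _ ↦ g.ext_fields fun X Z hX hZ ↦ by
        have hYY' : MDiffAt (T% (Y + Y')) x := mdifferentiableAt_add_section hY hY'
        simp only [add_apply, map_add]
        rw [g.val_nabla hX hYY' hZ, g.val_nabla hX hY hZ, g.val_nabla hX hY' hZ,
          g.koszul_add_middle hX hY hY' hZ]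
        ring
      leibniz := fun {Y f x} hY hf _ ↦ g.ext_fields fun X Z hX hZ ↦ by
        have hfY : MDiffAt (T% (f • Y)) x := hf.smul_section hY
        simp only [add_apply, smul_apply, map_add, map_smul, ContinuousLinearMap.smulRight_apply,
          smul_eq_mul]
        rw [g.val_nabla hX hfY hZ, g.val_nabla hX hY hZ, g.koszul_smul_middle hf hX hY hZ]
        ring }

theorem val_leviCivita (hX : MDiffAt (T% X) x) (hY : MDiffAt (T% Y) x)
    (hZ : MDiffAt (T% Z) x) :
    g.val x (g.leviCivita Y x (X x)) (Z x) = 1 / 2 * g.koszul X Y Z x :=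
  g.val_nabla hX hY hZ

/-- The Levi-Civita connection is torsion-free. -/
theorem leviCivita_torsionFree (hX : MDiffAt (T% X) x) (hY : MDiffAt (T% Y) x) :
    g.leviCivita Y x (X x) - g.leviCivita X x (Y x) = VectorField.mlieBracket I X Y x := by
  refine g.eq_of_val_eq fun u ↦ ?_
  have hZ := FiberBundle.mdifferentiableAt_extend I E u
  have h1 := g.val_leviCivita hX hY hZ
  have h2 := g.val_leviCivita hY hX hZ
  rw [koszul, FiberBundle.extend_apply_self] at h1 h2
  rw [VectorField.mlieBracket_swap_apply (V := Y), g.inner_comm Y X] at h2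
  simp only [map_sub, sub_apply, map_neg, neg_apply] at h1 h2 ⊢
  linarith

/-- The Levi-Civita connection is compatible with the metric. -/
theorem leviCivita_metric (hX : MDiffAt (T% X) x) (hY : MDiffAt (T% Y) x)
    (hZ : MDiffAt (T% Z) x) :
    d% (g.inner Y Z) x (X x) =
      g.val x (g.leviCivita Y x (X x)) (Z x) + g.val x (Y x) (g.leviCivita Z x (X x)) := by
  rw [g.symm x (Y x), g.val_leviCivita hX hY hZ, g.val_leviCivita hX hZ hY, koszul, koszul,
    VectorField.mlieBracket_swap_apply (V := Z) (W := Y), g.inner_comm Z Y]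
  simp only [map_neg, neg_apply]
  ring

/-- The Riemann curvature `R(X,Y)Z = ∇_X ∇_Y Z - ∇_Y ∇_X Z - ∇_{[X,Y]} Z`. -/
def riemann (X Y Z : ∀ x : M, TangentSpace I x) (x : M) : TangentSpace I x :=
  g.leviCivita (fun y ↦ g.leviCivita Z y (Y y)) x (X x)
    - g.leviCivita (fun y ↦ g.leviCivita Z y (X y)) x (Y x)
    - g.leviCivita Z x (VectorField.mlieBracket I X Y x)

/-- The Ricci curvature `S_x(v,w)`, the trace of `u ↦ R(u,v)w` on `T_x M`. The trace is the sum of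
the diagonal coefficients in a basis of `T_x M`, and `R`, being tensorial, is evaluated on tangent
vectors by extending them to vector fields that are smooth near `x`. -/
def ricci (x : M) (v w : TangentSpace I x) : ℝ :=
  haveI : FiniteDimensional ℝ (TangentSpace I x) := finiteDimensional_tangentSpace x
  ∑ i, (Module.finBasis ℝ (TangentSpace I x)).repr
    (g.riemann (FiberBundle.extend E (Module.finBasis ℝ (TangentSpace I x) i))
      (FiberBundle.extend E v) (FiberBundle.extend E w) x) i

/-- `(∇_X S)(Y,Z) = X(S(Y,Z)) - S(∇_X Y,Z) - S(Y,∇_X Z)` for the Ricci tensor `S`. -/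
def covDerivRicci (X Y Z : ∀ x : M, TangentSpace I x) (x : M) : ℝ :=
  d% (fun y ↦ g.ricci y (Y y) (Z y)) x (X x)
    - g.ricci x (g.leviCivita Y x (X x)) (Z x)
    - g.ricci x (Y x) (g.leviCivita Z x (X x))

/-- `(𝓛_ξ g)(X,Y) = ξ(g(X,Y)) - g([ξ,X],Y) - g(X,[ξ,Y])`. -/
def lieDerivMetric (ξ X Y : ∀ x : M, TangentSpace I x) (x : M) : ℝ :=
  d% (g.inner X Y) x (ξ x)
    - g.val x (VectorField.mlieBracket I ξ X x) (Y x)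
    - g.val x (X x) (VectorField.mlieBracket I ξ Y x)

/-- The metric is Lorentzian, i.e. of signature `(-,+,…,+)`: each tangent space contains a timelike
vector whose orthogonal complement is spacelike. -/
def IsLorentzian : Prop :=
  ∀ x : M, ∃ v : TangentSpace I x, g.val x v v < 0 ∧
    ∀ w : TangentSpace I x, g.val x v w = 0 → w ≠ 0 → 0 < g.val x w w

/-- `(g, ξ, η, φ, α)` is an `(LCS)_n`-structure: `g` is Lorentzian, `ξ` is a smooth unit timelike
vector field, `η = g(ξ, ·)`, `φ = I + η ⊗ ξ`, and `∇ξ = α (I + η ⊗ ξ)` with `α` a nowhere zero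
smooth function such that `dα = ρ η` for some smooth function `ρ`. -/
structure IsLCSStructure (ξ : ∀ x : M, TangentSpace I x) (η : ∀ x : M, TangentSpace I x →L[ℝ] ℝ)
    (φ : ∀ x : M, TangentSpace I x →L[ℝ] TangentSpace I x) (α : M → ℝ) : Prop where
  lorentzian : g.IsLorentzian
  smooth_xi : CMDiff ∞ (T% ξ)
  unit_timelike : ∀ x, g.val x (ξ x) (ξ x) = -1
  eta_eq : ∀ x v, η x v = g.val x (ξ x) v
  phi_eq : ∀ x v, φ x v = v + η x v • ξ x
  smooth_alpha : CMDiff ∞ α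
  alpha_ne_zero : ∀ x, α x ≠ 0
  nabla_xi : ∀ x v, g.leviCivita ξ x v = α x • (v + η x v • ξ x)
  concircular : ∃ ρ : M → ℝ, CMDiff ∞ ρ ∧ ∀ x v, d% α x v = ρ x * η x v

/-- `(g, ξ, lam, mu)` is an almost `η`-Ricci soliton:
`𝓛_ξ g + 2 S + 2 lam g + 2 mu η ⊗ η = 0` with `lam` and `mu` smooth functions. -/
structure IsAlmostEtaRicciSoliton (ξ : ∀ x : M, TangentSpace I x)
    (η : ∀ x : M, TangentSpace I x →L[ℝ] ℝ) (lam mu : M → ℝ) : Prop where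
  smooth_lam : CMDiff ∞ lam
  smooth_mu : CMDiff ∞ mu
  soliton_eq : ∀ X Y : ∀ x : M, TangentSpace I x, CMDiff ∞ (T% X) → CMDiff ∞ (T% Y) → ∀ x,
    g.lieDerivMetric ξ X Y x + 2 * g.ricci x (X x) (Y x) + 2 * lam x * g.val x (X x) (Y x)
      + 2 * mu x * (η x (X x) * η x (Y x)) = 0

/-- `∇S = 0`. -/
def IsRicciSymmetric : Prop :=
  ∀ X Y Z : ∀ x : M, TangentSpace I x, CMDiff ∞ (T% X) → CMDiff ∞ (T% Y) → CMDiff ∞ (T% Z) →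
    ∀ x, g.covDerivRicci X Y Z x = 0

/-- `∇S = η ⊗ S`. -/
def IsEtaRecurrentRicci (η : ∀ x : M, TangentSpace I x →L[ℝ] ℝ) : Prop :=
  ∀ X Y Z : ∀ x : M, TangentSpace I x, CMDiff ∞ (T% X) → CMDiff ∞ (T% Y) → CMDiff ∞ (T% Z) →
    ∀ x, g.covDerivRicci X Y Z x = η x (X x) * g.ricci x (Y x) (Z x)

/-- `(∇_X S)(Y,Z) = (∇_Y S)(X,Z)`. -/
def IsCodazziRicci : Prop :=
  ∀ X Y Z : ∀ x : M, TangentSpace I x, CMDiff ∞ (T% X) → CMDiff ∞ (T% Y) → CMDiff ∞ (T% Z) →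
    ∀ x, g.covDerivRicci X Y Z x = g.covDerivRicci Y X Z x

end

end PseudoRiemannianMetric
end

/-!
Write `κ = α² + ξ(α)`. Everything follows from the value of the Ricci tensor on `ξ` and from the
fact that the soliton equation prescribes the Ricci tensor.

Differentiating `∇_Y ξ = α (Y + η(Y) ξ)` and using `dα = -ξ(α) η` gives
`R(X,Y)ξ = κ (η(Y) X - η(X) Y)`, whose trace is `S(Y,ξ) = (n - 1) κ η(Y)`
(`IsLCSStructure.riemann_xi`, `IsLCSStructure.ricci_xi`). Since `𝓛_ξ g = 2 α (g + η ⊗ η)`, the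
soliton equation reads `S = -(α + λ) g - (α + μ) η ⊗ η` (`IsLCSStructure.ricci_eq`). Together they
give
`(∇_X S)(Y,ξ) = (n - 1) dκ(X) η(Y) + c (g + η ⊗ η)(X,Y)`
for some function `c` (`IsLCSStructure.covDerivRicci_xi`). The last term is symmetric and is
annihilated by `ξ`. So `∇S = 0` forces `dκ = 0` (take `Y = ξ`), `∇S = η ⊗ S` forces `ξ(κ) = -κ`
(take `X = Y = ξ`), and a Codazzi tensor `S` forces `dκ ⊗ η` to be symmetric.

The Ricci tensor evaluates the curvature on local extensions of tangent vectors, and `ξ` is not such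
an extension, so the computation needs `R(X,Y)Z` to depend on `Z` only pointwise
(`riemann_congr_right`). This is deduced from the skew-adjointness of `R(X,Y)`
(`val_riemann_skew`), which rests on two facts: `[X,Y]` acts on functions as the commutator of `X`
and `Y` (`mvfderiv_mlieBracket_apply`, read off from the Jacobi identity), and `∇_X Y` is smooth
when `X` and `Y` are (`contMDiffAt_leviCivita`, from the Koszul formula and Cramer's rule).
-/

/-! ### Smooth functions and vector fields near a point -/

section Manifold

variable {E : Type*} [NormedAddCommGroup E] [NormedSpace ℝ E]
  {H : Type*} [TopologicalSpace H] {I : ModelWithCorners ℝ E H}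
  {M : Type*} [TopologicalSpace M] [ChartedSpace H M]

theorem contMDiffAt_matrix_det {ι : Type*} [Fintype ι] [DecidableEq ι] {k : ℕ∞ω}
    {A : M → Matrix ι ι ℝ} {x : M} (hA : ∀ i j, CMDiffAt k (fun y ↦ A y i j) x) :
    CMDiffAt k (fun y ↦ (A y).det) x := by
  simp only [Matrix.det_apply']
  refine contMDiffAt_finsetSum fun σ _ ↦ contMDiffAt_const.mul ?_
  exact contMDiffAt_finsetProd fun i _ ↦ hA _ _

theorem mvfderiv_congr {f f' : M → ℝ} {x : M} (h : f =ᶠ[𝓝 x] f') :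
    mvfderiv I f x = mvfderiv I f' x := by
  ext v
  simp only [mvfderiv, h.mfderiv_eq]
  rfl

variable [IsManifold I ∞ M]

theorem contMDiffAt_mvfderiv_apply {f : M → ℝ} {X : ∀ x : M, TangentSpace I x} {x : M}
    (hf : CMDiffAt ∞ f x) (hX : CMDiffAt ∞ (T% X) x) :
    CMDiffAt ∞ (fun y ↦ d% f y (X y)) x := by
  have h := ContMDiffAt.clm_apply_of_inCoordinates (E₁ := fun y : M ↦ TangentSpace I y)
    (E₂ := fun y : ℝ ↦ TangentSpace 𝓘(ℝ, ℝ) y) (b₁ := id) (b₂ := f)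
    (ϕ := fun y ↦ mfderiv I 𝓘(ℝ, ℝ) f y) (v := X)
    (hf.mfderiv_const (m := ∞) (by simp)) hX hf
  rw [Bundle.contMDiffAt_totalSpace] at h
  simpa [mvfderiv, NormedSpace.fromTangentSpace] using! h.2

theorem eventually_mdifferentiableAt {f : M → ℝ} {x : M} (hf : CMDiffAt ∞ f x) :
    ∀ᶠ y in 𝓝 x, MDiffAt f y := by
  have h1 : CMDiffAt 1 f x := hf.of_le (by simp)
  have := (contMDiffAt_iff_contMDiffAt_nhds (by simp)).1 h1
  exact this.mono fun y hy ↦ hy.mdifferentiableAt one_ne_zero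

theorem eventually_mdifferentiableAt_section {X : ∀ x : M, TangentSpace I x} {x : M}
    (hX : CMDiffAt ∞ (T% X) x) :
    ∀ᶠ y in 𝓝 x, MDiffAt (T% X) y := by
  have h1 : CMDiffAt 1 (T% X) x := hX.of_le (by simp)
  have := (contMDiffAt_iff_contMDiffAt_nhds (by simp)).1 h1
  exact this.mono fun y hy ↦ hy.mdifferentiableAt one_ne_zero

end Manifold

/-! ### The commutator of two directional derivatives -/

section Bracket

variable {E : Type*} [NormedAddCommGroup E] [NormedSpace ℝ E] [FiniteDimensional ℝ E]
  {H : Type*} [TopologicalSpace H] {I : ModelWithCorners ℝ E H}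
  {M : Type*} [TopologicalSpace M] [ChartedSpace H M] [IsManifold I ∞ M]

open VectorField

theorem contMDiffAt_mlieBracket {X Y : ∀ x : M, TangentSpace I x} {x : M}
    (hX : CMDiffAt ∞ (T% X) x) (hY : CMDiffAt ∞ (T% Y) x) :
    CMDiffAt ∞ (T% (mlieBracket I X Y)) x := by
  have : CompleteSpace E := FiniteDimensional.complete ℝ E
  have : IsManifold I (minSmoothness ℝ 2) M := by
    rw [minSmoothness_of_isRCLikeNormedField]; infer_instance
  have : IsManifold I (((⊤ : ℕ∞) : ℕ∞ω) + 1) M := inferInstanceAs (IsManifold I ∞ M)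
  refine ContMDiffAt.mlieBracket_vectorField (m := ⊤) (n := ⊤) hX hY ?_
  rw [minSmoothness_of_isRCLikeNormedField]
  exact le_rfl

/-- The identity `X(Y(f)) - Y(X(f)) = [X,Y](f)`. It is the coefficient of `W` in the Jacobi
identity for `X`, `Y` and `f W`, where `W` is any field that does not vanish at the point. -/
theorem mvfderiv_mlieBracket_apply {X Y : ∀ x : M, TangentSpace I x} {f : M → ℝ} {x : M}
    (hX : CMDiffAt ∞ (T% X) x) (hY : CMDiffAt ∞ (T% Y) x) (hf : CMDiffAt ∞ f x) :
    d% f x (mlieBracket I X Y x) =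
      d% (fun y ↦ d% f y (Y y)) x (X x) - d% (fun y ↦ d% f y (X y)) x (Y x) := by
  have : CompleteSpace E := FiniteDimensional.complete ℝ E
  have : IsManifold I (minSmoothness ℝ 3) M := by
    rw [minSmoothness_of_isRCLikeNormedField]
    exact IsManifold.of_le (n := ∞) ENat.LEInfty.out
  rcases subsingleton_or_nontrivial (TangentSpace I x) with h0 | h0
  · simp [Subsingleton.elim (mlieBracket I X Y x) 0, Subsingleton.elim (X x) 0,
      Subsingleton.elim (Y x) 0]
  obtain ⟨w, hw⟩ := exists_ne (0 : TangentSpace I x)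
  set W := FiberBundle.extend E w
  have hW : CMDiffAt ∞ (T% W) x := FiberBundle.contMDiffAt_extend I E w
  have hWx : W x = w := FiberBundle.extend_apply_self E w
  have two : ∀ {Z : ∀ x : M, TangentSpace I x}, CMDiffAt ∞ (T% Z) x →
      CMDiffAt (minSmoothness ℝ 2) (T% Z) x := fun hZ ↦ by
    rw [minSmoothness_of_isRCLikeNormedField]
    exact hZ.of_le ENat.LEInfty.out
  have md : ∀ {Z : ∀ x : M, TangentSpace I x}, CMDiffAt ∞ (T% Z) x → MDiffAt (T% Z) x :=
    fun hZ ↦ hZ.mdifferentiableAt (by simp)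
  have hfW : CMDiffAt ∞ (T% (f • W)) x := hf.smul_section hW
  have near : ∀ V : ∀ x : M, TangentSpace I x, mlieBracket I V (f • W) =ᶠ[𝓝 x]
      (fun y ↦ d% f y (V y)) • W + f • mlieBracket I V W := fun V ↦ by
    filter_upwards [eventually_mdifferentiableAt (I := I) hf,
      eventually_mdifferentiableAt_section hW] with y h1 h2
    exact mlieBracket_smul_right h1 h2
  have double : ∀ U V : ∀ x : M, TangentSpace I x, CMDiffAt ∞ (T% V) x →
      mlieBracket I U (mlieBracket I V (f • W)) x =
        d% (fun y ↦ d% f y (V y)) x (U x) • W x + d% f x (V x) • mlieBracket I U W x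
        + (d% f x (U x) • mlieBracket I V W x + f x • mlieBracket I U (mlieBracket I V W) x) := by
    intro U V hV
    have hVf := contMDiffAt_mvfderiv_apply hf hV
    have hVW := contMDiffAt_mlieBracket hV hW
    rw [(Filter.EventuallyEq.refl _ U).mlieBracket_vectorField_eq (near V),
      mlieBracket_add_right (md (hVf.smul_section hW)) (md (hf.smul_section hVW)),
      mlieBracket_smul_right (hVf.mdifferentiableAt (by simp)) (md hW),
      mlieBracket_smul_right (hf.mdifferentiableAt (by simp)) (md hVW)]
  have jac := leibniz_identity_mlieBracket_apply (two hX) (two hY) (two hfW)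
  rw [double X Y hY, double Y X hX, (near (mlieBracket I X Y)).eq_of_nhds,
    Pi.add_apply, Pi.smul_apply', Pi.smul_apply',
    leibniz_identity_mlieBracket_apply (two hX) (two hY) (two hW)] at jac
  have key : (d% f x (mlieBracket I X Y x) -
      (d% (fun y ↦ d% f y (Y y)) x (X x) - d% (fun y ↦ d% f y (X y)) x (Y x))) • w = 0 := by
    rw [← hWx]
    refine Eq.trans ?_ (neg_eq_zero.2 (sub_eq_zero.2 jac))
    module
  rcases smul_eq_zero.1 key with h | h
  · linarith
  · exact absurd h hw

end Bracket

namespace PseudoRiemannianMetric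

variable {E : Type*} [NormedAddCommGroup E] [NormedSpace ℝ E] [FiniteDimensional ℝ E]
  {H : Type*} [TopologicalSpace H] {I : ModelWithCorners ℝ E H}
  {M : Type*} [TopologicalSpace M] [ChartedSpace H M] [IsManifold I ∞ M]
  (g : PseudoRiemannianMetric I M) {X Y Z W : ∀ x : M, TangentSpace I x} {x : M}

/-! ### Smoothness of the Levi-Civita connection -/

omit [FiniteDimensional ℝ E] in
theorem contMDiffAt_inner (hX : CMDiffAt ∞ (T% X) x) (hY : CMDiffAt ∞ (T% Y) x) :
    CMDiffAt ∞ (g.inner X Y) x := by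
  have h : ContMDiffAt I (I.prod 𝓘(ℝ)) ∞
      (fun m ↦ Bundle.TotalSpace.mk' ℝ (E := Bundle.Trivial M ℝ) m (g.val m (X m) (Y m))) x := by
    apply ContMDiffAt.clm_bundle_apply₂ (F₁ := E) (F₂ := E)
    · exact g.contMDiff.contMDiffAt
    · exact hX
    · exact hY
  simp only [Bundle.contMDiffAt_totalSpace] at h
  exact h.2

/-- A vector field is smooth as soon as its inner products with smooth fields are: by Cramer's rule
for the Gram matrix of a local frame, they determine its coefficients smoothly. -/
theorem contMDiffAt_of_inner
    (h : ∀ W : ∀ x : M, TangentSpace I x, CMDiffAt ∞ (T% W) x → CMDiffAt ∞ (g.inner X W) x) :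
    CMDiffAt ∞ (T% X) x := by
  classical
  set e := trivializationAt E (TangentSpace I : M → Type _) x
  have hx : x ∈ e.baseSet := FiberBundle.mem_baseSet_trivializationAt' x
  set b := Module.finBasis ℝ E
  set s := e.localFrame b
  have hs : IsLocalFrameOn I E ∞ s e.baseSet := e.isLocalFrameOn_localFrame_baseSet I ∞ b
  have hsm : ∀ i, CMDiffAt ∞ (T% (s i)) x := fun i ↦ hs.contMDiffAt e.open_baseSet hx i
  set A : M → Matrix _ _ ℝ := fun y ↦ Matrix.of fun i j ↦ g.inner (s i) (s j) y
  set θ : M → _ → ℝ := fun y i ↦ g.inner X (s i) y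
  have hdet : ∀ y ∈ e.baseSet, (A y).det ≠ 0 := fun y hy ↦ by
    have := (LinearMap.BilinForm.nondegenerate_iff_det_ne_zero (hs.toBasisAt hy)).1
      (g.bilin_nondegenerate y)
    convert this
    ext i j
    simp [A, inner, bilin, LinearMap.BilinForm.toMatrix_apply]
  have hcoeff : ∀ i, ∀ y ∈ e.baseSet,
      hs.coeff i y (X y) = (A y).det⁻¹ * (A y).cramer (θ y) i := fun i y hy ↦ by
    have hθ : θ y = (A y).mulVec fun j ↦ hs.coeff j y (X y) := by
      ext i
      have := hs.coeff_sum_eq X hy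
      simp only [θ, A, Matrix.mulVec, dotProduct, Matrix.of_apply, inner]
      conv_lhs => rw [this, g.symm]
      simp [mul_comm]
    rw [hθ, Matrix.cramer_eq_adjugate_mulVec, Matrix.mulVec_mulVec, Matrix.adjugate_mul,
      Matrix.smul_mulVec, Matrix.one_mulVec, Pi.smul_apply, smul_eq_mul,
      inv_mul_cancel_left₀ (hdet y hy)]
  refine hs.contMDiffAt_of_coeff (fun i ↦ ?_) (e.open_baseSet.mem_nhds hx)
  have hA : ∀ i j, CMDiffAt ∞ (fun y ↦ A y i j) x := fun i j ↦
    g.contMDiffAt_inner (hsm i) (hsm j)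
  have hsmooth : CMDiffAt ∞ (fun y ↦ (A y).det⁻¹ * (A y).cramer (θ y) i) x := by
    refine ContMDiffAt.mul ((contMDiffAt_matrix_det hA).inv₀ (hdet x hx)) ?_
    simp only [Matrix.cramer_apply]
    refine contMDiffAt_matrix_det fun k j ↦ ?_
    simp only [Matrix.updateCol_apply]
    split_ifs
    · exact h _ (hsm k)
    · exact hA k j
  exact hsmooth.congr_of_eventuallyEq
    (Filter.eventuallyEq_of_mem (e.open_baseSet.mem_nhds hx) fun y hy ↦ hcoeff i y hy)

theorem contMDiffAt_leviCivita (hX : CMDiffAt ∞ (T% X) x) (hY : CMDiffAt ∞ (T% Y) x) :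
    CMDiffAt ∞ (T% (fun y ↦ g.leviCivita Y y (X y))) x := by
  refine g.contMDiffAt_of_inner fun Z hZ ↦ ?_
  have hk : CMDiffAt ∞ (fun y ↦ 1 / 2 * g.koszul X Y Z y) x := by
    refine contMDiffAt_const.mul ?_
    have h1 := contMDiffAt_mvfderiv_apply (g.contMDiffAt_inner hY hZ) hX
    have h2 := contMDiffAt_mvfderiv_apply (g.contMDiffAt_inner hX hZ) hY
    have h3 := contMDiffAt_mvfderiv_apply (g.contMDiffAt_inner hX hY) hZ
    have h4 := g.contMDiffAt_inner (contMDiffAt_mlieBracket hX hY) hZ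
    have h5 := g.contMDiffAt_inner (contMDiffAt_mlieBracket hX hZ) hY
    have h6 := g.contMDiffAt_inner (contMDiffAt_mlieBracket hY hZ) hX
    exact ((((h1.add h2).sub h3).add h4).sub h5).sub h6
  refine hk.congr_of_eventuallyEq ?_
  filter_upwards [eventually_mdifferentiableAt_section hX, eventually_mdifferentiableAt_section hY,
    eventually_mdifferentiableAt_section hZ] with y h1 h2 h3
  exact g.val_leviCivita h1 h2 h3


/-! ### The curvature tensor -/

theorem mvfderiv_mvfderiv_inner (hX : CMDiffAt ∞ (T% X) x) (hY : CMDiffAt ∞ (T% Y) x)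
    (hZ : CMDiffAt ∞ (T% Z) x) (hW : CMDiffAt ∞ (T% W) x) :
    d% (fun y ↦ d% (g.inner Z W) y (Y y)) x (X x) =
      g.val x (g.leviCivita (fun y ↦ g.leviCivita Z y (Y y)) x (X x)) (W x)
      + g.val x (g.leviCivita Z x (Y x)) (g.leviCivita W x (X x))
      + (g.val x (g.leviCivita Z x (X x)) (g.leviCivita W x (Y x))
      + g.val x (Z x) (g.leviCivita (fun y ↦ g.leviCivita W y (Y y)) x (X x))) := by
  have md : ∀ {V : ∀ x : M, TangentSpace I x}, CMDiffAt ∞ (T% V) x → MDiffAt (T% V) x :=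
    fun hV ↦ hV.mdifferentiableAt (by simp)
  have hYZ := md (g.contMDiffAt_leviCivita hY hZ)
  have hYW := md (g.contMDiffAt_leviCivita hY hW)
  have near : (fun y ↦ d% (g.inner Z W) y (Y y)) =ᶠ[𝓝 x]
      fun y ↦ g.inner (fun y ↦ g.leviCivita Z y (Y y)) W y
        + g.inner Z (fun y ↦ g.leviCivita W y (Y y)) y := by
    filter_upwards [eventually_mdifferentiableAt_section hY,
      eventually_mdifferentiableAt_section hZ, eventually_mdifferentiableAt_section hW]
      with y h1 h2 h3
    exact g.leviCivita_metric h1 h2 h3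
  rw [mvfderiv_congr near, mvfderiv_fun_add (g.mdifferentiableAt_inner hYZ (md hW))
    (g.mdifferentiableAt_inner (md hZ) hYW), add_apply,
    g.leviCivita_metric (md hX) hYZ (md hW), g.leviCivita_metric (md hX) (md hZ) hYW]

/-- The curvature endomorphism `R(X,Y)` is skew-adjoint for the metric. -/
theorem val_riemann_skew (hX : CMDiffAt ∞ (T% X) x) (hY : CMDiffAt ∞ (T% Y) x)
    (hZ : CMDiffAt ∞ (T% Z) x) (hW : CMDiffAt ∞ (T% W) x) :
    g.val x (g.riemann X Y Z x) (W x) = -g.val x (Z x) (g.riemann X Y W x) := by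
  have md : ∀ {V : ∀ x : M, TangentSpace I x}, CMDiffAt ∞ (T% V) x → MDiffAt (T% V) x :=
    fun hV ↦ hV.mdifferentiableAt (by simp)
  have h := mvfderiv_mlieBracket_apply hX hY (g.contMDiffAt_inner hZ hW)
  rw [g.mvfderiv_mvfderiv_inner hX hY hZ hW, g.mvfderiv_mvfderiv_inner hY hX hZ hW,
    g.leviCivita_metric (md (contMDiffAt_mlieBracket hX hY)) (md hZ) (md hW)] at h
  simp only [riemann, map_sub, sub_apply]
  linarith

/-- The value of `R(X,Y)Z` at a point depends on `Z` only through its value there: by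
skew-adjointness, `g(R(X,Y)Z, W) = -g(Z, R(X,Y)W)`. -/
theorem riemann_congr_right {Z' : ∀ x : M, TangentSpace I x} (hX : CMDiffAt ∞ (T% X) x)
    (hY : CMDiffAt ∞ (T% Y) x) (hZ : CMDiffAt ∞ (T% Z) x) (hZ' : CMDiffAt ∞ (T% Z') x)
    (h : Z x = Z' x) : g.riemann X Y Z x = g.riemann X Y Z' x := by
  refine g.eq_of_val_eq fun w ↦ ?_
  have hW := FiberBundle.contMDiffAt_extend (k := ∞) I E w
  have h1 := g.val_riemann_skew hX hY hZ hW
  have h2 := g.val_riemann_skew hX hY hZ' hW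
  rw [FiberBundle.extend_apply_self] at h1 h2
  rw [h1, h2, h]

end PseudoRiemannianMetric

namespace PseudoRiemannianMetric

variable {E : Type*} [NormedAddCommGroup E] [NormedSpace ℝ E] [FiniteDimensional ℝ E]
  {H : Type*} [TopologicalSpace H] {I : ModelWithCorners ℝ E H}
  {M : Type*} [TopologicalSpace M] [ChartedSpace H M] [IsManifold I ∞ M]
  {g : PseudoRiemannianMetric I M} {X Y Z : ∀ x : M, TangentSpace I x} {x : M}

/-! ### Curvature and Ricci tensor of a Lorentzian concircular structure -/

namespace IsLCSStructure

variable {ξ : ∀ x : M, TangentSpace I x} {η : ∀ x : M, TangentSpace I x →L[ℝ] ℝ}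
  {φ : ∀ x : M, TangentSpace I x →L[ℝ] TangentSpace I x} {α : M → ℝ}

/-- The function `ρ` with `dα = ρ η` is `-ξ(α)`, since `η(ξ) = -1`. -/
theorem mvfderiv_alpha (h : g.IsLCSStructure ξ η φ α) (x : M) (v : TangentSpace I x) :
    d% α x v = -(VectorField.dirDeriv ξ α x * g.val x (ξ x) v) := by
  obtain ⟨ρ, -, hρ⟩ := h.concircular
  simp only [VectorField.dirDeriv, hρ, h.eta_eq, h.unit_timelike]
  ring

/-- The second covariant derivative `∇_X ∇_Y ξ`, by the Leibniz rule applied to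
`∇_Y ξ = α (Y + η(Y) ξ)`. -/
theorem leviCivita_leviCivita_xi (h : g.IsLCSStructure ξ η φ α) (hX : CMDiffAt ∞ (T% X) x)
    (hY : CMDiffAt ∞ (T% Y) x) :
    g.leviCivita (fun y ↦ g.leviCivita ξ y (Y y)) x (X x) =
      α x • (g.leviCivita Y x (X x)
        + (g.val x (ξ x) (Y x) • α x • (X x + g.val x (ξ x) (X x) • ξ x)
          + (α x * (g.val x (X x) (Y x) + g.val x (ξ x) (X x) * g.val x (ξ x) (Y x))
            + g.val x (ξ x) (g.leviCivita Y x (X x))) • ξ x))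
      - (VectorField.dirDeriv ξ α x * g.val x (ξ x) (X x)) •
        (Y x + g.val x (ξ x) (Y x) • ξ x) := by
  have hξ : MDiffAt (T% ξ) x := h.smooth_xi.contMDiffAt.mdifferentiableAt (by simp)
  have hα : MDiffAt α x := h.smooth_alpha.contMDiffAt.mdifferentiableAt (by simp)
  have hX' : MDiffAt (T% X) x := hX.mdifferentiableAt (by simp)
  have hY' : MDiffAt (T% Y) x := hY.mdifferentiableAt (by simp)
  have hin : MDiffAt (g.inner ξ Y) x := g.mdifferentiableAt_inner hξ hY'
  have hsec : MDiffAt (T% (g.inner ξ Y • ξ)) x := hin.smul_section hξ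
  have hsum : MDiffAt (T% (Y + g.inner ξ Y • ξ)) x := mdifferentiableAt_add_section hY' hsec
  have heq : (fun y ↦ g.leviCivita ξ y (Y y)) = α • (Y + g.inner ξ Y • ξ) := by
    ext1 y
    simp [h.nabla_xi, h.eta_eq, inner]
  have hcov := g.leviCivita.isCovariantDerivativeOnUniv
  have e1 := hcov.leibniz hsum hα
  have e2 := hcov.add hY' hsec
  have e3 := hcov.leibniz hξ hin
  rw [heq, e1, e2, e3]
  simp only [add_apply, smul_apply, ContinuousLinearMap.smulRight_apply, h.mvfderiv_alpha,
    g.leviCivita_metric hX' hξ hY', h.nabla_xi, h.eta_eq, map_add, map_smul, inner,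
    Pi.add_apply, Pi.smul_apply', smul_eq_mul]
  module

/-- The curvature of a Lorentzian concircular structure in the direction of `ξ`:
`R(X,Y)ξ = (α² + ξ(α)) (η(Y) X - η(X) Y)`. -/
theorem riemann_xi (h : g.IsLCSStructure ξ η φ α) (hX : CMDiffAt ∞ (T% X) x)
    (hY : CMDiffAt ∞ (T% Y) x) :
    g.riemann X Y ξ x = (α x ^ 2 + VectorField.dirDeriv ξ α x) •
      (g.val x (ξ x) (Y x) • X x - g.val x (ξ x) (X x) • Y x) := by
  have htor := g.leviCivita_torsionFree (hX.mdifferentiableAt (by simp))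
    (hY.mdifferentiableAt (by simp))
  rw [riemann, h.leviCivita_leviCivita_xi hX hY, h.leviCivita_leviCivita_xi hY hX, ← htor,
    h.nabla_xi, h.eta_eq, g.symm x (Y x) (X x), map_sub]
  module

/-- The Ricci tensor of a Lorentzian concircular structure in the direction of `ξ`:
`S(v,ξ) = (n - 1) (α² + ξ(α)) η(v)`. -/
theorem ricci_xi (h : g.IsLCSStructure ξ η φ α) (x : M) (v : TangentSpace I x) :
    g.ricci x v (ξ x) = (Module.finrank ℝ E - 1) *
      (α x ^ 2 + VectorField.dirDeriv ξ α x) * g.val x (ξ x) v := by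
  have : FiniteDimensional ℝ (TangentSpace I x) := finiteDimensional_tangentSpace x
  set b := Module.finBasis ℝ (TangentSpace I x)
  have hR : ∀ u : TangentSpace I x, g.riemann (FiberBundle.extend E u) (FiberBundle.extend E v)
      (FiberBundle.extend E (ξ x)) x = (α x ^ 2 + VectorField.dirDeriv ξ α x) •
        (g.val x (ξ x) v • u - g.val x (ξ x) u • v) := fun u ↦ by
    have hu := FiberBundle.contMDiffAt_extend (k := ∞) I E u
    have hv := FiberBundle.contMDiffAt_extend (k := ∞) I E v
    rw [g.riemann_congr_right hu hv (FiberBundle.contMDiffAt_extend (k := ∞) I E (ξ x))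
      h.smooth_xi.contMDiffAt (FiberBundle.extend_apply_self E (ξ x)), h.riemann_xi hu hv,
      FiberBundle.extend_apply_self, FiberBundle.extend_apply_self]
  have hv : ∑ i, b.repr v i * g.val x (ξ x) (b i) = g.val x (ξ x) v := by
    simpa only [map_sum, map_smul, smul_eq_mul] using congrArg (g.val x (ξ x)) (b.sum_repr v)
  have hcard : (Module.finrank ℝ (TangentSpace I x) : ℝ) = Module.finrank ℝ E := rfl
  simp only [ricci, hR, map_smul, map_sub, Finsupp.smul_apply, Finsupp.sub_apply,
    Module.Basis.repr_self, Finsupp.single_eq_same, smul_eq_mul, ← Finset.mul_sum,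
    Finset.sum_sub_distrib, mul_one, Finset.sum_const, Finset.card_univ, Fintype.card_fin,
    nsmul_eq_mul]
  simp only [mul_comm (g.val x (ξ x) (b _)), b, ← hcard] at hv ⊢
  rw [hv]
  ring

theorem contMDiff_sq_add_dirDeriv (h : g.IsLCSStructure ξ η φ α) :
    CMDiff ∞ (fun x ↦ α x ^ 2 + VectorField.dirDeriv ξ α x) := fun _ ↦
  (h.smooth_alpha.contMDiffAt.pow 2).add
    (contMDiffAt_mvfderiv_apply h.smooth_alpha.contMDiffAt h.smooth_xi.contMDiffAt)

end IsLCSStructure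

end PseudoRiemannianMetric

/-! ### Globally smooth extensions and locally constant functions -/

section Manifold

variable {E : Type*} [NormedAddCommGroup E] [NormedSpace ℝ E] [FiniteDimensional ℝ E]
  {H : Type*} [TopologicalSpace H] {I : ModelWithCorners ℝ E H}
  {M : Type*} [TopologicalSpace M] [ChartedSpace H M] [IsManifold I ∞ M]

/-- On a Hausdorff manifold every tangent vector is the value of a globally smooth vector field,
obtained by cutting off a local extension with a bump function. -/
theorem exists_contMDiff_vectorField [T2Space M] (x : M) (v : TangentSpace I x) :
    ∃ X : ∀ x : M, TangentSpace I x, CMDiff ∞ (T% X) ∧ X x = v := by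
  obtain ⟨s, hs, hX⟩ := FiberBundle.exists_contMDiffOn_extend (k := ∞) I E v
  obtain ⟨u, hus, hu, hxu⟩ := mem_nhds_iff.1 hs
  obtain ⟨ψ, -, hψ⟩ := (SmoothBumpFunction.nhds_basis_tsupport (I := I) x).mem_iff.1
    (hu.mem_nhds hxu)
  refine ⟨(ψ : M → ℝ) • FiberBundle.extend E v,
    ContMDiffOn.smul_section_of_tsupport ψ.contMDiff.contMDiffOn hu hψ (hX.mono hus), ?_⟩
  simp

omit [FiniteDimensional ℝ E] in
theorem isLocallyConstant_of_mvfderiv_eq_zero [I.Boundaryless] {f : M → ℝ} (hf : CMDiff ∞ f)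
    (h : ∀ x, mvfderiv I f x = 0) : IsLocallyConstant f := by
  rw [IsLocallyConstant.iff_eventually_eq]
  intro x
  have hopen := isOpen_extChartAt_target (I := I) x
  obtain ⟨r, hr, hball⟩ := Metric.isOpen_iff.1 hopen _ (mem_extChartAt_target (I := I) x)
  have hderiv : ∀ z ∈ Metric.ball (extChartAt I x x) r,
      HasFDerivAt (f ∘ (extChartAt I x).symm) (0 : E →L[ℝ] ℝ) z := fun z hz ↦ by
    have h1 : MDifferentiableAt 𝓘(ℝ, E) I (extChartAt I x).symm z :=
      (contMDiffOn_extChartAt_symm (n := ∞) x |>.contMDiffAt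
        (hopen.mem_nhds (hball hz))).mdifferentiableAt (by simp)
    have h2 : MDiffAt f ((extChartAt I x).symm z) := hf.contMDiffAt.mdifferentiableAt (by simp)
    have h3 := mvfderiv_comp z h2 h1
    rw [h, ContinuousLinearMap.zero_comp] at h3
    have h4 := (h2.comp z h1).differentiableAt.hasFDerivAt
    have h5 : fderiv ℝ (f ∘ (extChartAt I x).symm) z = 0 := by
      rw [← mfderiv_eq_fderiv]
      exact h3
    rwa [h5] at h4
  have hconst : ∀ z ∈ Metric.ball (extChartAt I x x) r,
      f ((extChartAt I x).symm z) = f x := fun z hz ↦ by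
    have := Metric.isOpen_ball.is_const_of_fderiv_eq_zero (𝕜 := ℝ)
      (convex_ball _ _).isPreconnected
      (fun z hz ↦ (hderiv z hz).differentiableAt.differentiableWithinAt)
      (fun z hz ↦ (hderiv z hz).fderiv) hz (Metric.mem_ball_self hr)
    simpa using this
  filter_upwards [extChartAt_source_mem_nhds (I := I) x,
    (continuousAt_extChartAt (I := I) x).preimage_mem_nhds (Metric.ball_mem_nhds _ hr)] with y h1 h2
  rw [← hconst _ h2, (extChartAt I x).left_inv h1]

end Manifold

namespace PseudoRiemannianMetric

variable {E : Type*} [NormedAddCommGroup E] [NormedSpace ℝ E] [FiniteDimensional ℝ E]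
  {H : Type*} [TopologicalSpace H] {I : ModelWithCorners ℝ E H}
  {M : Type*} [TopologicalSpace M] [ChartedSpace H M] [IsManifold I ∞ M]
  {g : PseudoRiemannianMetric I M} {X Y Z : ∀ x : M, TangentSpace I x} {x : M}

/-! ### The Ricci tensor of an almost `η`-Ricci soliton -/

namespace IsLCSStructure

variable {ξ : ∀ x : M, TangentSpace I x} {η : ∀ x : M, TangentSpace I x →L[ℝ] ℝ}
  {φ : ∀ x : M, TangentSpace I x →L[ℝ] TangentSpace I x} {α lam mu : M → ℝ}

theorem lieDerivMetric_xi (h : g.IsLCSStructure ξ η φ α) (hX : MDiffAt (T% X) x)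
    (hY : MDiffAt (T% Y) x) : g.lieDerivMetric ξ X Y x =
      2 * α x * (g.val x (X x) (Y x) + g.val x (ξ x) (X x) * g.val x (ξ x) (Y x)) := by
  have hξ : MDiffAt (T% ξ) x := h.smooth_xi.contMDiffAt.mdifferentiableAt (by simp)
  rw [lieDerivMetric, g.leviCivita_metric hξ hX hY, ← g.leviCivita_torsionFree hξ hX,
    ← g.leviCivita_torsionFree hξ hY]
  simp only [h.nabla_xi, h.eta_eq, map_add, map_sub, map_smul, sub_apply, add_apply, smul_apply,
    smul_eq_mul, g.symm x (X x) (ξ x)]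
  ring

theorem ricci_eq [T2Space M] (h : g.IsLCSStructure ξ η φ α)
    (hsol : g.IsAlmostEtaRicciSoliton ξ η lam mu) (x : M) (v w : TangentSpace I x) :
    g.ricci x v w = -(α x + lam x) * g.val x v w
      - (α x + mu x) * (g.val x (ξ x) v * g.val x (ξ x) w) := by
  obtain ⟨X, hX, rfl⟩ := exists_contMDiff_vectorField x v
  obtain ⟨Y, hY, rfl⟩ := exists_contMDiff_vectorField x w
  have := hsol.soliton_eq X Y hX hY x
  rw [h.lieDerivMetric_xi (hX.contMDiffAt.mdifferentiableAt (by simp))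
    (hY.contMDiffAt.mdifferentiableAt (by simp)), h.eta_eq, h.eta_eq] at this
  linarith

/-- Up to a multiple of the symmetric form `g + η ⊗ η`, which `ξ` annihilates, the form
`(X,Y) ↦ (∇_X S)(Y,ξ)` is `(n - 1) d(α² + ξ(α)) ⊗ η`. -/
theorem covDerivRicci_xi [T2Space M] (h : g.IsLCSStructure ξ η φ α)
    (hsol : g.IsAlmostEtaRicciSoliton ξ η lam mu) (hX : CMDiff ∞ (T% X)) (hY : CMDiff ∞ (T% Y))
    (x : M) : g.covDerivRicci X Y ξ x =
      (Module.finrank ℝ E - 1) * (d% (fun y ↦ α y ^ 2 + VectorField.dirDeriv ξ α y) x (X x)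
        * g.val x (ξ x) (Y x))
      + ((Module.finrank ℝ E - 1) * (α x ^ 2 + VectorField.dirDeriv ξ α x) + α x + lam x) * α x
        * (g.val x (X x) (Y x) + g.val x (ξ x) (X x) * g.val x (ξ x) (Y x)) := by
  have hξ : MDiffAt (T% ξ) x := h.smooth_xi.contMDiffAt.mdifferentiableAt (by simp)
  have hX' : MDiffAt (T% X) x := hX.contMDiffAt.mdifferentiableAt (by simp)
  have hY' : MDiffAt (T% Y) x := hY.contMDiffAt.mdifferentiableAt (by simp)
  have hκ : MDiffAt (fun y ↦ α y ^ 2 + VectorField.dirDeriv ξ α y) x :=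
    h.contMDiff_sq_add_dirDeriv.contMDiffAt.mdifferentiableAt (by simp)
  have hfun : (fun y ↦ g.ricci y (Y y) (ξ y)) = fun y ↦ (Module.finrank ℝ E - 1 : ℝ) *
      ((α y ^ 2 + VectorField.dirDeriv ξ α y) * g.inner ξ Y y) := by
    ext1 y
    rw [h.ricci_xi, inner, mul_assoc]
  have hin := g.mdifferentiableAt_inner hξ hY'
  have hprod : MDiffAt (fun y ↦ (α y ^ 2 + VectorField.dirDeriv ξ α y) * g.inner ξ Y y) x :=
    hκ.mul hin
  rw [covDerivRicci, hfun, mvfderiv_fun_mul mdifferentiableAt_const hprod,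
    mvfderiv_fun_mul hκ hin, h.ricci_xi, h.ricci_eq hsol]
  simp only [add_apply, smul_apply, smul_eq_mul, mvfderiv_const, zero_apply, mul_zero, add_zero,
    g.leviCivita_metric hX' hξ hY', h.nabla_xi, h.eta_eq, map_add, map_smul, h.unit_timelike,
    inner, g.symm x (Y x) (X x), g.symm x (Y x) (ξ x)]
  ring

end IsLCSStructure

end PseudoRiemannianMetric

/-! ### Almost `η`-Ricci solitons on Lorentzian concircular manifolds -/

theorem proposition3p2 {n : ℕ} (hn : 2 < n) {M : Type*} [TopologicalSpace M] [T2Space M]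
    [ChartedSpace (EuclideanSpace ℝ (Fin n)) M] [IsManifold (𝓡 n) ∞ M]
    (g : PseudoRiemannianMetric (𝓡 n) M) (ξ : ∀ x : M, TangentSpace (𝓡 n) x)
    (η : ∀ x : M, TangentSpace (𝓡 n) x →L[ℝ] ℝ)
    (φ : ∀ x : M, TangentSpace (𝓡 n) x →L[ℝ] TangentSpace (𝓡 n) x) (α lam mu : M → ℝ)
    (hLCS : g.IsLCSStructure ξ η φ α) (hsol : g.IsAlmostEtaRicciSoliton ξ η lam mu) :
    (g.IsRicciSymmetric →
      IsLocallyConstant (fun x ↦ α x ^ 2 + VectorField.dirDeriv ξ α x)) ∧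
    (g.IsEtaRecurrentRicci η → ∀ x,
      α x ^ 2 + (1 + 2 * α x) * VectorField.dirDeriv ξ α x
        + VectorField.dirDeriv ξ (VectorField.dirDeriv ξ α) x = 0) ∧
    (g.IsCodazziRicci → ∀ (x : M) (v w : TangentSpace (𝓡 n) x),
      mvfderiv (𝓡 n) (fun y ↦ α y ^ 2 + VectorField.dirDeriv ξ α y) x v * η x w =
        η x v * mvfderiv (𝓡 n) (fun y ↦ α y ^ 2 + VectorField.dirDeriv ξ α y) x w) := by
  have hrank : (Module.finrank ℝ (EuclideanSpace ℝ (Fin n)) : ℝ) - 1 ≠ 0 := by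
    have : (2 : ℝ) < n := by exact_mod_cast hn
    rw [finrank_euclideanSpace_fin]
    linarith
  have hξ := hLCS.smooth_xi
  -- In each case `covDerivRicci_xi` is evaluated where its symmetric term drops out: at `(v,ξ)`,
  -- at `(ξ,ξ)`, and after antisymmetrization in `(v,w)`.
  refine ⟨fun hS ↦ ?_, fun hS x ↦ ?_, fun hS x v w ↦ ?_⟩
  · refine isLocallyConstant_of_mvfderiv_eq_zero hLCS.contMDiff_sq_add_dirDeriv fun x ↦ ?_
    ext v
    obtain ⟨X, hX, rfl⟩ := exists_contMDiff_vectorField x v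
    have h := hLCS.covDerivRicci_xi hsol hX hξ x
    rw [hS X ξ ξ hX hξ hξ x, hLCS.unit_timelike, g.symm x (X x) (ξ x)] at h
    apply mul_left_cancel₀ hrank
    rw [zero_apply]
    linarith
  · have h := hLCS.covDerivRicci_xi hsol hξ hξ x
    rw [hS ξ ξ ξ hξ hξ hξ x, hLCS.ricci_xi, hLCS.eta_eq, hLCS.unit_timelike] at h
    have hα : MDifferentiableAt (𝓡 n) 𝓘(ℝ, ℝ) α x :=
      hLCS.smooth_alpha.contMDiffAt.mdifferentiableAt (by simp)
    have hα' : MDifferentiableAt (𝓡 n) 𝓘(ℝ, ℝ) (VectorField.dirDeriv ξ α) x :=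
      (contMDiffAt_mvfderiv_apply hLCS.smooth_alpha.contMDiffAt
        hξ.contMDiffAt).mdifferentiableAt (by simp)
    have hd : mvfderiv (𝓡 n) (fun y ↦ α y ^ 2 + VectorField.dirDeriv ξ α y) x (ξ x) =
        2 * α x * VectorField.dirDeriv ξ α x
          + VectorField.dirDeriv ξ (VectorField.dirDeriv ξ α) x := by
      simp only [pow_two]
      have hα2 : MDifferentiableAt (𝓡 n) 𝓘(ℝ, ℝ) (fun y ↦ α y * α y) x := hα.mul hα
      rw [mvfderiv_fun_add hα2 hα', mvfderiv_fun_mul hα hα]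
      simp only [add_apply, smul_apply, smul_eq_mul, VectorField.dirDeriv]
      ring
    rw [hd] at h
    apply mul_left_cancel₀ hrank
    linarith
  · obtain ⟨X, hX, rfl⟩ := exists_contMDiff_vectorField x v
    obtain ⟨Y, hY, rfl⟩ := exists_contMDiff_vectorField x w
    have h := hS X Y ξ hX hY hξ x
    rw [hLCS.covDerivRicci_xi hsol hX hY, hLCS.covDerivRicci_xi hsol hY hX,
      g.symm x (Y x) (X x)] at h
    apply mul_left_cancel₀ hrank
    rw [hLCS.eta_eq, hLCS.eta_eq]
    linarith
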